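/- Let $q>1$ be real and let $\mu$ be a positive integer. Put $[j]_q=\sum_{n=0}^{j-1}q^n$, $[l]_q!=[1]_q[2]_q\cdots[l]_q$ with $[0]_q!=1$, and consider the moment sequence $m=([p]_q!)_{p\ge 0}$, whose moment derivative acts on functions as Jackson's $q$-derivative $$D_qf(z)=\frac{f(qz)-f(z)}{qz-z}.$$ Let $\mu_1=\dfrac{m(\mu)}{m(\mu-1)}$ and $U=\mathbb{C}\setminus[0,\infty)$. Then $U$ is a domain (open and connected) with $0\in\overline{U}$, and there exists a sequence of functions $(H_p)_{p\ge 0}$, meromorphic on $\mathbb{C}\setminus\{0\}$ and holomorphic on $U$ (so that all their poles in $\mathbb{C}\setminus\{0\}$ are positive real numbers), such that $H_1(z)=z^{\mu}$ and, for every $p\ge 1$ and every $z\in U$, $$z\,D_q(H_{p+1})(z)=\mu_1H_{p+1}(z)+H_p(z),$$ or, in the form of a $q$-difference equation, $$H_{p+1}(qz)=\bigl(1+(q-1)[\mu]_q\bigr)H_{p+1}(z)+(q-1)H_p(z).$$ -/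

import Mathlib

/-- The `q`-number `[j]_q = 1 + q + ⋯ + q ^ (j - 1)`. -/
noncomputable def qNumber (q : ℝ) (j : ℕ) : ℝ := ∑ n ∈ Finset.range j, q ^ n

/-- The `q`-factorial `[l]_q! = [1]_q [2]_q ⋯ [l]_q`, with `[0]_q! = 1`. As a function of `l` it is
the moment sequence `m = ([p]_q!)_{p ≥ 0}`. -/
noncomputable def qFactorial (q : ℝ) (l : ℕ) : ℝ := ∏ j ∈ Finset.range l, qNumber q (j + 1)

/-- The formal moment derivative attached to a sequence `m`, sending `∑ (a_p / m_p) z ^ p` to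
`∑ (a_{p+1} / m_p) z ^ p`; in terms of the coefficients `b_p = a_p / m_p` of the series, the new
coefficients are `b_{p+1} m_{p+1} / m_p`. -/
noncomputable def momentDeriv (m : ℕ → ℝ) (f : PowerSeries ℂ) : PowerSeries ℂ :=
  PowerSeries.mk fun p => PowerSeries.coeff (p + 1) f * (m (p + 1) : ℂ) / (m p : ℂ)

/-- Jackson's `q`-derivative `D_q f (z) = (f (q z) - f z) / (q z - z)`: the form the moment
derivative for `m = ([p]_q!)_{p ≥ 0}` takes on functions (see `hasSum_qDeriv`). -/
noncomputable def qDeriv (q : ℝ) (f : ℂ → ℂ) (z : ℂ) : ℂ :=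
  (f ((q : ℂ) * z) - f z) / ((q : ℂ) * z - z)

/-- The complex plane cut along the half-line `[0, ∞)`. -/
def cutPlane : Set ℂ := ((fun x : ℝ => (x : ℂ)) '' Set.Ici 0)ᶜ

/-- On the sum of a convergent power series, Jackson's `q`-derivative is the moment derivative for
the sequence of `q`-factorials. -/
theorem hasSum_qDeriv (q : ℝ) (hq : 1 < q) (a : PowerSeries ℂ) (f : ℂ → ℂ) (z : ℂ) (hz : z ≠ 0)
    (h : HasSum (fun p => PowerSeries.coeff p a * z ^ p) (f z))
    (hh : HasSum (fun p => PowerSeries.coeff p a * ((q : ℂ) * z) ^ p) (f ((q : ℂ) * z))) :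
    HasSum (fun p => PowerSeries.coeff p (momentDeriv (qFactorial q) a) * z ^ p)
      (qDeriv q f z) := by
  have hpos : ∀ j : ℕ, 0 < qNumber q (j + 1) := fun j =>
    Finset.sum_pos (fun n _ => pow_pos (by linarith) n) ⟨0, by simp⟩
  have hfac : ∀ p : ℕ, ((qFactorial q p : ℝ) : ℂ) ≠ 0 := fun p => by
    exact_mod_cast (Finset.prod_pos fun j _ => hpos j).ne'
  have hq1 : ((q : ℂ) - 1) ≠ 0 := by
    rw [sub_ne_zero]; exact_mod_cast hq.ne'
  have hd : (q : ℂ) * z - z ≠ 0 := by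
    have := mul_ne_zero hq1 hz
    rwa [sub_mul, one_mul] at this
  have key := (hh.sub h).div_const ((q : ℂ) * z - z)
  rw [← hasSum_nat_add_iff' 1] at key
  simp only [Finset.range_one, Finset.sum_singleton, pow_zero, sub_self, zero_div, sub_zero] at key
  have hfun : ∀ p, PowerSeries.coeff p (momentDeriv (qFactorial q) a) * z ^ p =
      (PowerSeries.coeff (p + 1) a * ((q : ℂ) * z) ^ (p + 1) -
        PowerSeries.coeff (p + 1) a * z ^ (p + 1)) / ((q : ℂ) * z - z) := by
    intro p
    have hg : ((q : ℂ) - 1) * (qNumber q (p + 1) : ℂ) = (q : ℂ) ^ (p + 1) - 1 := by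
      have := mul_geom_sum (q : ℂ) (p + 1)
      simpa [qNumber] using this
    have hs : ((qFactorial q (p + 1) : ℝ) : ℂ) = qFactorial q p * qNumber q (p + 1) := by
      simp [qFactorial, Finset.prod_range_succ]
    have hfp := hfac p
    rw [momentDeriv, PowerSeries.coeff_mk, hs, eq_div_iff hd, mul_pow]
    field_simp
    linear_combination (PowerSeries.coeff (p + 1) a * z ^ (p + 1)) * hg
  simp only [hfun]
  simpa [qDeriv] using key

/-!
The substitution `H_{k+1} = z ^ μ ((q - 1) / q ^ μ) ^ k u_k` turns the recursion into
`u_{k+1}(q z) = u_{k+1}(z) + u_k(z)` with `u_0 = 1`, because `1 + (q - 1) [μ]_q = q ^ μ`. By Pascal's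
rule it is solved by the binomial coefficients `u_k = binom(L, k)` of any function `L` with
`L(q z) = L(z) + 1`. The logarithm in base `q` is such a function, but it is not meromorphic on
`ℂ ∖ {0}`; it is replaced by the meromorphic solution `qThetaLog`, the logarithmic derivative `z θ'/θ`
of the Jacobi theta function with simple zeros at the integral powers of `q`.

The theta function itself is not needed. With `A(z) = ∑ₙ z / (z - q ^ n)` (`qPoleSum`), one has
`L(z) = A(z) - A(1 / (q z))`. Shifting the summation index gives
`A(q z) = A(z) + q z / (q z - 1)` (`qPoleSum_mul`), whence the equation for `L`
(`qThetaLog_mul`). After finitely many terms are split off, the series converges uniformly on a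
given disc (`exists_tail_differentiableOn`), so `A` is meromorphic on `ℂ`, with poles at most at the
points `q ^ n`.
-/

/-- The series `∑ z / (z - q ^ n)` over `n ≥ 0`, with simple poles at the points `q ^ n`. -/
noncomputable def qPoleSum (q : ℝ) (z : ℂ) : ℂ := ∑' n : ℕ, z / (z - (q : ℂ) ^ n)

/-- The `q`-analogue of the logarithm in base `q` that is meromorphic on `ℂ ∖ {0}`: the logarithmic
derivative `z θ'(z) / θ(z)` of the theta function `∏ (1 - z / q ^ n) (1 - 1 / (q ^ (n + 1) z))`,
products over `n ≥ 0`. -/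
noncomputable def qThetaLog (q : ℝ) (z : ℂ) : ℂ := qPoleSum q z - qPoleSum q (((q : ℂ) * z)⁻¹)

/-- The solution `z ^ μ ((q - 1) / q ^ μ) ^ k binom(L(z), k)`, `p = k + 1`, of the recursion. Its
value `0` at `p = 0` is the one the recursion at `p = 0` would force. -/
noncomputable def qLogSolution (q : ℝ) (μ : ℕ) : ℕ → ℂ → ℂ
  | 0, _ => 0
  | k + 1, z => z ^ μ * (((q : ℂ) - 1) / (q : ℂ) ^ μ) ^ k * Ring.choose (qThetaLog q z) k

/-! ### The cut plane -/

theorem mem_cutPlane_iff {z : ℂ} : z ∈ cutPlane ↔ -z ∈ Complex.slitPlane := by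
  rw [Complex.mem_slitPlane_iff, cutPlane, Set.mem_compl_iff, Set.mem_image]
  constructor
  · intro h
    by_contra! hc
    simp only [Complex.neg_re, Complex.neg_im] at hc
    exact h ⟨z.re, by simpa using hc.1, Complex.ext rfl (neg_eq_zero.1 hc.2).symm⟩
  · rintro h ⟨x, hx, rfl⟩
    have hx' : (0 : ℝ) ≤ x := hx
    rcases h with h | h
    · simp only [Complex.neg_re, Complex.ofReal_re] at h
      linarith
    · simp at h

theorem cutPlane_eq_preimage : cutPlane = Neg.neg ⁻¹' Complex.slitPlane :=
  Set.ext fun _ => mem_cutPlane_iff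

theorem isOpen_cutPlane : IsOpen cutPlane := by
  rw [cutPlane_eq_preimage]
  exact Complex.isOpen_slitPlane.preimage continuous_neg

theorem isConnected_cutPlane : IsConnected cutPlane := by
  have h := (Complex.starConvex_one_slitPlane.isPathConnected
    Complex.one_mem_slitPlane).isConnected.image Neg.neg continuous_neg.continuousOn
  rwa [Set.image_neg_eq_neg, ← Set.neg_preimage, ← cutPlane_eq_preimage] at h

theorem zero_mem_closure_cutPlane : (0 : ℂ) ∈ closure cutPlane := by
  refine Metric.mem_closure_iff.2 fun ε hε => ⟨((-(ε / 2) : ℝ) : ℂ), ?_, ?_⟩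
  · rw [mem_cutPlane_iff, ← Complex.ofReal_neg, Complex.ofReal_mem_slitPlane]
    linarith
  · rw [dist_zero_left, Complex.norm_real, Real.norm_eq_abs, abs_neg, abs_of_pos (by linarith)]
    linarith

theorem ne_ofReal_of_mem_cutPlane {z : ℂ} (hz : z ∈ cutPlane) {x : ℝ} (hx : 0 ≤ x) :
    z ≠ (x : ℂ) :=
  fun h => hz ⟨x, hx, h.symm⟩

/-! ### The meromorphic function `qPoleSum` -/

/-- On a disc, the terms with pole `q ^ n` far outside it are dominated by a geometric series. -/
theorem norm_div_sub_pow_le {q R : ℝ} (hq : 1 < q) {z : ℂ} (hz : ‖z‖ ≤ R) {n : ℕ}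
    (hn : 2 * R < q ^ n) :
    z - (q : ℂ) ^ n ≠ 0 ∧ ‖z / (z - (q : ℂ) ^ n)‖ ≤ 2 * R * q⁻¹ ^ n := by
  have hqn : 0 < q ^ n := pow_pos (by linarith) n
  have h1 : q ^ n / 2 ≤ ‖z - (q : ℂ) ^ n‖ := by
    have h2 : ‖(q : ℂ) ^ n‖ = q ^ n := by
      rw [norm_pow, Complex.norm_real, Real.norm_of_nonneg (by linarith)]
    have h3 := norm_sub_norm_le ((q : ℂ) ^ n) z
    rw [norm_sub_rev, h2] at h3
    linarith
  refine ⟨norm_pos_iff.1 (by linarith), ?_⟩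
  rw [norm_div, inv_pow]
  calc ‖z‖ / ‖z - (q : ℂ) ^ n‖ ≤ R / (q ^ n / 2) :=
        div_le_div₀ ((norm_nonneg z).trans hz) hz (by linarith) h1
    _ = 2 * R * (q ^ n)⁻¹ := by field_simp

theorem exists_forall_lt_pow {q : ℝ} (hq : 1 < q) (C : ℝ) : ∃ N : ℕ, ∀ n, C < q ^ (n + N) := by
  obtain ⟨N, hN⟩ := pow_unbounded_of_one_lt C hq
  exact ⟨N, fun n => hN.trans_le (pow_le_pow_right₀ hq.le (Nat.le_add_left N n))⟩

theorem summable_const_mul_inv_pow_add {q : ℝ} (hq : 1 < q) (C : ℝ) (N : ℕ) :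
    Summable fun n : ℕ => C * q⁻¹ ^ (n + N) :=
  ((summable_nat_add_iff N).2 (summable_geometric_of_lt_one (inv_nonneg.2 (by linarith))
    (inv_lt_one_of_one_lt₀ hq))).mul_left C

/-- The series converges at every point, its poles included: there one term is `z / 0 = 0`. -/
theorem summable_div_sub_pow {q : ℝ} (hq : 1 < q) (z : ℂ) :
    Summable fun n : ℕ => z / (z - (q : ℂ) ^ n) := by
  obtain ⟨N, hN⟩ := exists_forall_lt_pow hq (2 * ‖z‖)
  exact (summable_nat_add_iff N).1 (.of_norm_bounded
    (summable_const_mul_inv_pow_add hq (2 * ‖z‖) N)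
    fun n => (norm_div_sub_pow_le hq le_rfl (hN n)).2)

theorem qPoleSum_eq_sum_add_tail {q : ℝ} (hq : 1 < q) (N : ℕ) (z : ℂ) :
    qPoleSum q z = ∑ n ∈ Finset.range N, z / (z - (q : ℂ) ^ n) +
      ∑' n : ℕ, z / (z - (q : ℂ) ^ (n + N)) :=
  ((summable_div_sub_pow hq z).sum_add_tsum_nat_add N).symm

theorem exists_tail_differentiableOn {q : ℝ} (hq : 1 < q) (R : ℝ) : ∃ N : ℕ,
    DifferentiableOn ℂ (fun z : ℂ => ∑' n : ℕ, z / (z - (q : ℂ) ^ (n + N))) (Metric.ball 0 R) := by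
  obtain ⟨N, hN⟩ := exists_forall_lt_pow hq (2 * R)
  have hb : ∀ n : ℕ, ∀ z ∈ Metric.ball (0 : ℂ) R, _ := fun n z hz =>
    norm_div_sub_pow_le hq (mem_ball_zero_iff.1 hz).le (hN n)
  exact ⟨N, Complex.differentiableOn_tsum_of_summable_norm
    (summable_const_mul_inv_pow_add hq (2 * R) N)
    (fun n => differentiableOn_id.div (differentiableOn_id.sub_const _) fun z hz => (hb n z hz).1)
    Metric.isOpen_ball fun n z hz => (hb n z hz).2⟩

theorem meromorphicAt_qPoleSum {q : ℝ} (hq : 1 < q) (z : ℂ) : MeromorphicAt (qPoleSum q) z := by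
  obtain ⟨N, hN⟩ := exists_tail_differentiableOn hq (‖z‖ + 1)
  rw [funext (qPoleSum_eq_sum_add_tail hq N)]
  refine .add (.fun_sum fun n _ => (MeromorphicAt.id z).div ((MeromorphicAt.id z).sub (.const _ z)))
    (hN.analyticAt (Metric.isOpen_ball.mem_nhds ?_)).meromorphicAt
  simp

theorem differentiableAt_qPoleSum {q : ℝ} (hq : 1 < q) {z : ℂ} (hz : ∀ n : ℕ, z ≠ (q : ℂ) ^ n) :
    DifferentiableAt ℂ (qPoleSum q) z := by
  obtain ⟨N, hN⟩ := exists_tail_differentiableOn hq (‖z‖ + 1)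
  rw [funext (qPoleSum_eq_sum_add_tail hq N)]
  refine .add (.fun_sum fun n _ => differentiableAt_id.div (differentiableAt_id.sub_const _)
    (sub_ne_zero.2 (hz n))) (hN.differentiableAt (Metric.isOpen_ball.mem_nhds ?_))
  simp

theorem qPoleSum_mul {q : ℝ} (hq : 1 < q) (z : ℂ) :
    qPoleSum q ((q : ℂ) * z) = (q : ℂ) * z / ((q : ℂ) * z - 1) + qPoleSum q z := by
  have hq0 : (q : ℂ) ≠ 0 := by exact_mod_cast (by linarith : q ≠ 0)
  rw [qPoleSum, (summable_div_sub_pow hq _).tsum_eq_zero_add, pow_zero, qPoleSum]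
  congr 1
  refine tsum_congr fun n => ?_
  rw [pow_succ', ← mul_sub, mul_div_mul_left _ _ hq0]

/-! ### The `q`-logarithm -/

theorem qThetaLog_mul {q : ℝ} (hq : 1 < q) {z : ℂ} (hz : z ≠ 0) (hqz : (q : ℂ) * z ≠ 1) :
    qThetaLog q ((q : ℂ) * z) = qThetaLog q z + 1 := by
  have hq0 : (q : ℂ) ≠ 0 := by exact_mod_cast (by linarith : q ≠ 0)
  have h := qPoleSum_mul hq ((q : ℂ) * ((q : ℂ) * z))⁻¹
  have hw : (q : ℂ) * ((q : ℂ) * ((q : ℂ) * z))⁻¹ = ((q : ℂ) * z)⁻¹ := by field_simp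
  rw [hw] at h
  have h1 : (q : ℂ) * z - 1 ≠ 0 := sub_ne_zero.2 hqz
  have h2 : ((q : ℂ) * z)⁻¹ / (((q : ℂ) * z)⁻¹ - 1) = 1 - (q : ℂ) * z / ((q : ℂ) * z - 1) := by
    have h3 : (1 : ℂ) - (q : ℂ) * z ≠ 0 := sub_ne_zero.2 hqz.symm
    have h4 : ((q : ℂ) * z)⁻¹ - 1 = (1 - (q : ℂ) * z) / ((q : ℂ) * z) := by field_simp
    rw [h4, eq_sub_iff_add_eq, inv_div_left, ← neg_sub ((q : ℂ) * z) 1]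
    field_simp
    ring
  rw [qThetaLog, qThetaLog, qPoleSum_mul hq z, h, h2]
  ring

theorem meromorphicAt_qThetaLog {q : ℝ} (hq : 1 < q) {z : ℂ} (hz : z ≠ 0) :
    MeromorphicAt (qThetaLog q) z := by
  have hq0 : (q : ℂ) ≠ 0 := by exact_mod_cast (by linarith : q ≠ 0)
  exact (meromorphicAt_qPoleSum hq z).sub ((meromorphicAt_qPoleSum hq _).comp_analyticAt
    (g := fun z => ((q : ℂ) * z)⁻¹)
    ((analyticAt_const.mul analyticAt_id).inv (mul_ne_zero hq0 hz)))

theorem differentiableAt_qThetaLog {q : ℝ} (hq : 1 < q) {z : ℂ} (hz : z ∈ cutPlane) :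
    DifferentiableAt ℂ (qThetaLog q) z := by
  have hq' : 0 < q := by linarith
  have hq0 : (q : ℂ) ≠ 0 := by exact_mod_cast hq'.ne'
  have hz0 : z ≠ 0 := by simpa using ne_ofReal_of_mem_cutPlane hz le_rfl
  refine (differentiableAt_qPoleSum hq fun n => ?_).sub
    ((differentiableAt_qPoleSum hq fun n h => ?_).comp z
      ((differentiableAt_id.const_mul (q : ℂ)).inv (mul_ne_zero hq0 hz0)))
  · exact_mod_cast ne_ofReal_of_mem_cutPlane hz (pow_pos hq' n).le
  · refine ne_ofReal_of_mem_cutPlane hz (x := (q * q ^ n)⁻¹) (by positivity) ?_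
    have h' : ((q : ℂ) * z)⁻¹ = (q : ℂ) ^ n := h
    push_cast
    rw [mul_inv, ← h', inv_inv, inv_mul_cancel_left₀ hq0]

/-! ### The solutions of the recursion -/

theorem exists_polynomial_eval_eq_choose (k : ℕ) :
    ∃ P : Polynomial ℂ, ∀ x, Ring.choose x k = P.eval x := by
  refine ⟨Polynomial.C ((k.factorial : ℂ)⁻¹) * (descPochhammer ℤ k).map (Int.castRingHom ℂ),
    fun x => ?_⟩
  rw [Ring.choose_eq_smul, Polynomial.eval_mul, Polynomial.eval_C, smul_eq_mul,
    Polynomial.eval_map, ← Polynomial.eval₂_smulOneHom_eq_smeval]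
  congr 2
  exact Subsingleton.elim _ _

theorem meromorphicOn_qLogSolution {q : ℝ} (hq : 1 < q) (μ p : ℕ) :
    MeromorphicOn (qLogSolution q μ p) {0}ᶜ := by
  intro z hz
  cases p with
  | zero => exact .const 0 z
  | succ k =>
    obtain ⟨P, hP⟩ := exists_polynomial_eval_eq_choose k
    refine .mul (.mul ((MeromorphicAt.id z).pow μ) (.const _ z)) ?_
    simp only [hP, Polynomial.eval_eq_sum_range]
    exact .fun_sum fun i _ => .mul (.const _ z) ((meromorphicAt_qThetaLog hq hz).pow i)

theorem differentiableOn_qLogSolution {q : ℝ} (hq : 1 < q) (μ p : ℕ) :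
    DifferentiableOn ℂ (qLogSolution q μ p) cutPlane := by
  intro z hz
  refine DifferentiableAt.differentiableWithinAt ?_
  cases p with
  | zero => exact differentiableAt_const 0
  | succ k =>
    obtain ⟨P, hP⟩ := exists_polynomial_eval_eq_choose k
    refine .mul (.mul (differentiableAt_id.pow μ) (differentiableAt_const _)) ?_
    simp only [hP]
    exact P.differentiableAt.comp z (differentiableAt_qThetaLog hq hz)

theorem one_add_sub_one_mul_qNumber (q : ℝ) (j : ℕ) :
    1 + ((q : ℂ) - 1) * (qNumber q j : ℂ) = (q : ℂ) ^ j := by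
  have h : (q - 1) * qNumber q j = q ^ j - 1 := mul_geom_sum q j
  have h' : ((q : ℂ) - 1) * (qNumber q j : ℂ) = (q : ℂ) ^ j - 1 := by exact_mod_cast h
  rw [h']
  ring

theorem qLogSolution_succ_mul {q : ℝ} (hq : 1 < q) (μ : ℕ) {p : ℕ} (hp : 1 ≤ p) {z : ℂ}
    (hz : z ∈ cutPlane) :
    qLogSolution q μ (p + 1) ((q : ℂ) * z) =
      (1 + ((q : ℂ) - 1) * (qNumber q μ : ℂ)) * qLogSolution q μ (p + 1) z +
        ((q : ℂ) - 1) * qLogSolution q μ p z := by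
  obtain ⟨k, rfl⟩ := Nat.exists_eq_add_of_le' hp
  have hq' : 0 < q := by linarith
  have hq0 : (q : ℂ) ≠ 0 := by exact_mod_cast hq'.ne'
  have hz0 : z ≠ 0 := by simpa using ne_ofReal_of_mem_cutPlane hz le_rfl
  have hqz : (q : ℂ) * z ≠ 1 := fun h =>
    ne_ofReal_of_mem_cutPlane hz (x := q⁻¹) (by positivity) (by
      push_cast
      exact eq_inv_of_mul_eq_one_right h)
  rw [one_add_sub_one_mul_qNumber]
  simp only [qLogSolution]
  rw [qThetaLog_mul hq hz0 hqz, Ring.choose_succ_succ, mul_pow, pow_succ (_ / _)]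
  field_simp
  ring

theorem qFactorial_div_qFactorial_pred {q : ℝ} (hq : 1 < q) {μ : ℕ} (hμ : 0 < μ) :
    qFactorial q μ / qFactorial q (μ - 1) = qNumber q μ := by
  obtain ⟨k, rfl⟩ := Nat.exists_eq_add_of_le' hμ
  have hpos : 0 < qFactorial q k := Finset.prod_pos fun j _ =>
    Finset.sum_pos (fun n _ => pow_pos (by linarith) n) ⟨0, by simp⟩
  rw [Nat.add_sub_cancel, div_eq_iff hpos.ne', mul_comm]
  exact Finset.prod_range_succ _ _

theorem mainTheorem10 (q : ℝ) (hq : 1 < q) (μ : ℕ) (hμ : 0 < μ) :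
    IsOpen cutPlane ∧ IsConnected cutPlane ∧ (0 : ℂ) ∈ closure cutPlane ∧
    ∃ H : ℕ → ℂ → ℂ,
      (∀ z : ℂ, H 1 z = z ^ μ) ∧
      (∀ p : ℕ, DifferentiableOn ℂ (H p) cutPlane) ∧
      (∀ p : ℕ, MeromorphicOn (H p) {0}ᶜ) ∧
      (∀ p : ℕ, 1 ≤ p → ∀ z ∈ cutPlane,
        z * qDeriv q (H (p + 1)) z =
          ((qFactorial q μ / qFactorial q (μ - 1) : ℝ) : ℂ) * H (p + 1) z + H p z) ∧
      (∀ p : ℕ, 1 ≤ p → ∀ z ∈ cutPlane,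
        H (p + 1) ((q : ℂ) * z) =
          (1 + ((q : ℂ) - 1) * (qNumber q μ : ℂ)) * H (p + 1) z + ((q : ℂ) - 1) * H p z) := by
  refine ⟨isOpen_cutPlane, isConnected_cutPlane, zero_mem_closure_cutPlane, qLogSolution q μ,
    fun z => ?_, differentiableOn_qLogSolution hq μ, meromorphicOn_qLogSolution hq μ,
    fun p hp z hz => ?_, fun p hp z hz => qLogSolution_succ_mul hq μ hp hz⟩
  · simp [qLogSolution]
  · have hz0 : z ≠ 0 := by simpa using ne_ofReal_of_mem_cutPlane hz le_rfl
    have hq1 : (q : ℂ) - 1 ≠ 0 := sub_ne_zero.2 (by exact_mod_cast hq.ne')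
    have hd : (q : ℂ) * z - z = z * ((q : ℂ) - 1) := by ring
    rw [qFactorial_div_qFactorial_pred hq hμ, qDeriv, qLogSolution_succ_mul hq μ hp hz, hd]
    field_simp
    ring
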